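/- Let $A$ be a unital C*-algebra and $x\in A$. For a unital C*-algebra $C$ and $y\in C$ write $w(y)=\max\{|s(y)| : s \text{ a state of } C\}$ for the numerical radius (with $w=0$ on the zero algebra), write $C_+^{-1}$ for the set of positive invertible elements of $C$, and let $\otimes_{\min}$ denote the minimal (spatial) C*-tensor product. The following statements are equivalent: 1. $w(x)<\tfrac12$; 2. for every unital C*-algebra $B$ and every unitary $v\in B$, the element $x\otimes v\in A\otimes_{\min}B$ satisfies $w(x\otimes v)<\tfrac12$; 3. for every unital C*-algebra $B$ and every unitary $v\in B$, $\;1_A\otimes 1_B+x\otimes v+x^*\otimes v^*\in (A\otimes_{\min}B)_+^{-1}$; 4. $1_A\otimes 1_B+x\otimes u+x^*\otimes u^*\in (A\otimes_{\min}B)_+^{-1}$, where $B$ is the universal C*-algebra generated by a (universal) unitary $u$, i.e. $B=C(\mathbb T)$ and $u$ is the inclusion $\mathbb T\hookrightarrow\mathbb C$; 5. $1+zx+\bar z x^*\in A_+^{-1}$ for every $z\in\mathbb T=\{z\in\mathbb C:|z|=1\}$; 6. there exist $a,b\in A_+^{-1}$ with $a+b=1$ such that $$\begin{bmatrix} a &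 x\\ x^* & b\end{bmatrix}\in M_2(A)_+^{-1},$$ that is, the matrix is positive and invertible in $M_2(A)$. -/

import Mathlib

open scoped TensorProduct ComplexOrder InnerProductSpace

noncomputable section

/-! ### States and the numerical radius -/

/-- The states of a unital C⋆-algebra: the positive linear functionals that take the value `1`
at the unit. -/
def CStarState (A : Type*) [CStarAlgebra A] [PartialOrder A] : Type _ :=
  {s : A →ₚ[ℂ] ℂ // s 1 = 1}

/-- The numerical radius of an element of a unital C⋆-algebra: the supremum (it is a maximum, the
state space being weak-⋆ compact) of `|s(x)|` over all states `s`. The range is bounded, see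
`bddAbove_norm_state`; for the zero algebra, which has no state, the value is `0`. -/
def numericalRadius {A : Type*} [CStarAlgebra A] [PartialOrder A] (x : A) : ℝ :=
  ⨆ s : CStarState A, ‖s.1 x‖

theorem norm_state_apply_le {A : Type*} [CStarAlgebra A] [PartialOrder A] [StarOrderedRing A]
    (s : CStarState A) (x : A) : ‖s.1 x‖ ≤ ‖x‖ := by
  have key : ∀ y : A, ‖s.1.toPreGNS y‖ ≤ ‖y‖ * ‖s.1.toPreGNS 1‖ := fun y => by
    have h := (s.1.leftMulMapPreGNS y).le_of_opNorm_le
      (LinearMap.mkContinuous_norm_le _ (norm_nonneg y) _) (s.1.toPreGNS 1)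
    simpa using h
  have h1 : ‖s.1.toPreGNS (1 : A)‖ = 1 := by
    rw [PositiveLinearMap.preGNS_norm_def]
    simp [s.2]
  have hx : s.1 x = inner ℂ (s.1.toPreGNS 1) (s.1.toPreGNS x) := by
    rw [PositiveLinearMap.preGNS_inner_def]
    simp
  rw [hx]
  refine (norm_inner_le_norm _ _).trans ?_
  simpa [h1] using key x

theorem bddAbove_norm_state {A : Type*} [CStarAlgebra A] [PartialOrder A] [StarOrderedRing A]
    (x : A) : BddAbove (Set.range fun s : CStarState A => ‖s.1 x‖) :=
  ⟨‖x‖, by rintro _ ⟨s, rfl⟩; exact norm_state_apply_le s x⟩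

/-! ### The universal representation -/

/-- The Hilbert space direct sum of a family of unital ⋆-representations. -/
def directSumRep {A : Type*} [CStarAlgebra A] {ι : Type*} (H : ι → Type*)
    [∀ i, NormedAddCommGroup (H i)] [∀ i, InnerProductSpace ℂ (H i)] [∀ i, CompleteSpace (H i)]
    (π : ∀ i, A →⋆ₐ[ℂ] (H i →L[ℂ] H i)) : A →⋆ₐ[ℂ] (lp H 2 →L[ℂ] lp H 2) where
  toFun a := lp.mapCLM 2 (fun i => π i a) (norm_nonneg a)
    (fun i => NonUnitalStarAlgHom.norm_apply_le (π i) a)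
  map_one' := by ext v i; simp
  map_mul' a b := by ext v i; simp
  map_zero' := by ext v i; simp
  map_add' a b := by ext v i; simp
  commutes' r := by ext v i; simp [Algebra.algebraMap_eq_smul_one]
  map_star' a := by
    rw [ContinuousLinearMap.star_eq_adjoint, ContinuousLinearMap.eq_adjoint_iff]
    intro v w
    simp only [lp.inner_eq_tsum]
    congr 1
    ext i
    simp [map_star, ContinuousLinearMap.star_eq_adjoint, ContinuousLinearMap.adjoint_inner_left]

/-- The space of the universal representation: the Hilbert space direct sum of the GNS spaces of
all states. -/
abbrev UniversalSpace (A : Type*) [CStarAlgebra A] [PartialOrder A] [StarOrderedRing A] :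
    Type _ :=
  lp (fun s : CStarState A => s.1.GNS) 2

/-- The universal representation of a unital C⋆-algebra: the direct sum of the GNS representations
of all states. It is faithful. -/
def universalRep (A : Type*) [CStarAlgebra A] [PartialOrder A] [StarOrderedRing A] :
    A →⋆ₐ[ℂ] (UniversalSpace A →L[ℂ] UniversalSpace A) :=
  directSumRep (fun s : CStarState A => s.1.GNS) (fun s => s.1.gnsStarAlgHom)

/-! ### The minimal (spatial) tensor product -/

/-- The Hilbert space tensor product: the completion of the algebraic tensor product with respect
to the inner product `⟪ξ ⊗ η, ξ' ⊗ η'⟫ = ⟪ξ, ξ'⟫ * ⟪η, η'⟫`. -/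
def HilbertTensor (H K : Type*) [NormedAddCommGroup H] [InnerProductSpace ℂ H]
    [NormedAddCommGroup K] [InnerProductSpace ℂ K] : Type _ :=
  UniformSpace.Completion (H ⊗[ℂ] K)

namespace HilbertTensor

variable {H K : Type*} [NormedAddCommGroup H] [InnerProductSpace ℂ H]
  [NormedAddCommGroup K] [InnerProductSpace ℂ K]

instance : NormedAddCommGroup (HilbertTensor H K) :=
  inferInstanceAs (NormedAddCommGroup (UniformSpace.Completion (H ⊗[ℂ] K)))

instance : InnerProductSpace ℂ (HilbertTensor H K) :=
  inferInstanceAs (InnerProductSpace ℂ (UniformSpace.Completion (H ⊗[ℂ] K)))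

instance : CompleteSpace (HilbertTensor H K) :=
  inferInstanceAs (CompleteSpace (UniformSpace.Completion (H ⊗[ℂ] K)))

/-- The inclusion of the algebraic tensor product. -/
def incl (H K : Type*) [NormedAddCommGroup H] [InnerProductSpace ℂ H]
    [NormedAddCommGroup K] [InnerProductSpace ℂ K] : H ⊗[ℂ] K →ₗᵢ[ℂ] HilbertTensor H K :=
  UniformSpace.Completion.toComplₗᵢ (𝕜 := ℂ) (E := H ⊗[ℂ] K)

theorem denseRange_incl : DenseRange (incl H K) :=
  UniformSpace.Completion.denseRange_coe (α := H ⊗[ℂ] K)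

theorem inner_incl (x y : H ⊗[ℂ] K) : inner ℂ (incl H K x) (incl H K y) = inner ℂ x y :=
  (incl H K).inner_map_map x y

end HilbertTensor

/-- The operator `S ⊗ T` on the Hilbert space tensor product. -/
def opTensor {H K : Type*} [NormedAddCommGroup H] [InnerProductSpace ℂ H]
    [NormedAddCommGroup K] [InnerProductSpace ℂ K] (S : H →L[ℂ] H) (T : K →L[ℂ] K) :
    HilbertTensor H K →L[ℂ] HilbertTensor H K :=
  ContinuousLinearMap.completion (TensorProduct.mapL S T)

theorem opTensor_incl {H K : Type*} [NormedAddCommGroup H] [InnerProductSpace ℂ H]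
    [NormedAddCommGroup K] [InnerProductSpace ℂ K] (S : H →L[ℂ] H) (T : K →L[ℂ] K)
    (x : H ⊗[ℂ] K) :
    opTensor S T (HilbertTensor.incl H K x)
      = HilbertTensor.incl H K (TensorProduct.mapL S T x) :=
  ContinuousLinearMap.completion_apply_coe (TensorProduct.mapL S T) x

theorem opTensor_ext {H K : Type*} [NormedAddCommGroup H] [InnerProductSpace ℂ H]
    [NormedAddCommGroup K] [InnerProductSpace ℂ K]
    {X Y : HilbertTensor H K →L[ℂ] HilbertTensor H K}
    (h : ∀ x : H ⊗[ℂ] K, X (HilbertTensor.incl H K x) = Y (HilbertTensor.incl H K x)) :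
    X = Y :=
  ContinuousLinearMap.coeFn_injective
    (HilbertTensor.denseRange_incl.equalizer X.continuous Y.continuous (funext h))

theorem opTensor_mul {H K : Type*} [NormedAddCommGroup H] [InnerProductSpace ℂ H]
    [NormedAddCommGroup K] [InnerProductSpace ℂ K] (S S' : H →L[ℂ] H) (T T' : K →L[ℂ] K) :
    opTensor (S * S') (T * T') = opTensor S T * opTensor S' T' :=
  opTensor_ext fun x => by simp [opTensor_incl, TensorProduct.mapL_mul]

theorem opTensor_one {H K : Type*} [NormedAddCommGroup H] [InnerProductSpace ℂ H]
    [NormedAddCommGroup K] [InnerProductSpace ℂ K] :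
    opTensor (1 : H →L[ℂ] H) (1 : K →L[ℂ] K) = 1 :=
  opTensor_ext fun x => by
    rw [opTensor_incl, ContinuousLinearMap.one_def, ContinuousLinearMap.one_def,
      TensorProduct.mapL_id_id]
    rfl

theorem opTensor_star {H K : Type*} [NormedAddCommGroup H] [InnerProductSpace ℂ H]
    [CompleteSpace H] [NormedAddCommGroup K] [InnerProductSpace ℂ K] [CompleteSpace K]
    (S : H →L[ℂ] H) (T : K →L[ℂ] K) :
    star (opTensor S T) = opTensor (star S) (star T) := by
  have key : ∀ x y : H ⊗[ℂ] K, inner ℂ (TensorProduct.mapL (star S) (star T) x) y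
      = inner ℂ x (TensorProduct.mapL S T y) := fun x y => by
    induction x using TensorProduct.induction_on with
    | zero => simp
    | add x₁ x₂ h₁ h₂ => rw [map_add, inner_add_left, inner_add_left, h₁, h₂]
    | tmul a b =>
      induction y using TensorProduct.induction_on with
      | zero => simp
      | add y₁ y₂ h₁ h₂ => rw [map_add, inner_add_right, inner_add_right, h₁, h₂]
      | tmul c d =>
        simp [ContinuousLinearMap.star_eq_adjoint, ContinuousLinearMap.adjoint_inner_left]
  symm
  rw [ContinuousLinearMap.star_eq_adjoint (opTensor S T), ContinuousLinearMap.eq_adjoint_iff]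
  intro v w
  refine HilbertTensor.denseRange_incl.induction_on₂
    (p := fun v w => inner ℂ (opTensor (star S) (star T) v) w = inner ℂ v (opTensor S T w))
    (isClosed_eq (by fun_prop) (by fun_prop)) (fun x y => ?_) v w
  rw [opTensor_incl, opTensor_incl, HilbertTensor.inner_incl, HilbertTensor.inner_incl, key]

/-- `opTensor` as a bilinear map. -/
def opTensorₗ (H K : Type*) [NormedAddCommGroup H] [InnerProductSpace ℂ H]
    [NormedAddCommGroup K] [InnerProductSpace ℂ K] :
    (H →L[ℂ] H) →ₗ[ℂ] (K →L[ℂ] K) →ₗ[ℂ] (HilbertTensor H K →L[ℂ] HilbertTensor H K) :=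
  LinearMap.mk₂ ℂ opTensor
    (fun S S' T => opTensor_ext fun x => by
      simp [opTensor_incl, TensorProduct.mapL_add_left])
    (fun c S T => opTensor_ext fun x => by
      simp [opTensor_incl, TensorProduct.mapL_smul_left])
    (fun S T T' => opTensor_ext fun x => by
      simp [opTensor_incl, TensorProduct.mapL_add_right])
    (fun c S T => opTensor_ext fun x => by
      simp [opTensor_incl, TensorProduct.mapL_smul_right])

/-- The tensor product `π ⊗ σ` of two representations, `a ⊗ b ↦ π(a) ⊗ σ(b)`, as a
⋆-representation of the algebraic tensor product. -/
def tensorRep {A B H K : Type*} [CStarAlgebra A] [CStarAlgebra B]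
    [NormedAddCommGroup H] [InnerProductSpace ℂ H] [CompleteSpace H]
    [NormedAddCommGroup K] [InnerProductSpace ℂ K] [CompleteSpace K]
    (π : A →⋆ₐ[ℂ] (H →L[ℂ] H)) (σ : B →⋆ₐ[ℂ] (K →L[ℂ] K)) :
    A ⊗[ℂ] B →⋆ₐ[ℂ] (HilbertTensor H K →L[ℂ] HilbertTensor H K) where
  toAlgHom := Algebra.TensorProduct.algHomOfLinearMapTensorProduct
    (TensorProduct.lift ((opTensorₗ H K).compl₁₂ π.toAlgHom.toLinearMap σ.toAlgHom.toLinearMap))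
    (fun a a' b b' => by simp [opTensorₗ, opTensor_mul])
    (by simp [opTensorₗ, opTensor_one])
  map_star' z := by
    induction z using TensorProduct.induction_on with
    | zero => simp
    | add x y hx hy => simp_all
    | tmul a b => simp [opTensorₗ, opTensor_star, map_star]

/-- The minimal tensor product `A ⊗_min B` of two unital C⋆-algebras: the norm closure of the
algebraic tensor product, faithfully represented on the Hilbert space tensor product of the spaces
of the universal representations of `A` and `B`. -/
def MinTensor (A B : Type*) [CStarAlgebra A] [PartialOrder A] [StarOrderedRing A]
    [CStarAlgebra B] [PartialOrder B] [StarOrderedRing B] : Type _ :=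
  (tensorRep (universalRep A) (universalRep B)).range.topologicalClosure

namespace MinTensor

variable {A B : Type*} [CStarAlgebra A] [PartialOrder A] [StarOrderedRing A]
  [CStarAlgebra B] [PartialOrder B] [StarOrderedRing B]

/-- The C⋆-algebra structure inherited from the bounded operators. -/
instance : CStarAlgebra (MinTensor A B) :=
  StarSubalgebra.cstarAlgebra
    (tensorRep (universalRep A) (universalRep B)).range.topologicalClosure
    (h_closed := StarSubalgebra.isClosed_topologicalClosure _)

/-- The order whose positive elements are the self-adjoint ones with spectrum in `[0, ∞)`. -/
instance : PartialOrder (MinTensor A B) := CStarAlgebra.spectralOrder _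

instance : StarOrderedRing (MinTensor A B) := CStarAlgebra.spectralOrderedRing _

/-- The canonical ⋆-homomorphism from the algebraic tensor product. -/
def ofTensor (A B : Type*) [CStarAlgebra A] [PartialOrder A] [StarOrderedRing A]
    [CStarAlgebra B] [PartialOrder B] [StarOrderedRing B] : A ⊗[ℂ] B →⋆ₐ[ℂ] MinTensor A B :=
  (StarSubalgebra.inclusion (StarSubalgebra.le_topologicalClosure _)).comp
    (tensorRep (universalRep A) (universalRep B)).rangeRestrict

/-- The elementary tensor `a ⊗ b` in `A ⊗_min B`. -/
def tmul (a : A) (b : B) : MinTensor A B := ofTensor A B (a ⊗ₜ[ℂ] b)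

end MinTensor

/-! ### The universal C⋆-algebra generated by a unitary -/

/-- The universal C⋆-algebra generated by a unitary, realised as `C(𝕋)`; the universal property is
`existsUnique_universalUnitary_lift`. -/
abbrev UniversalUnitaryAlgebra : Type := C(Circle, ℂ)

/-- The universal unitary: the inclusion of the unit circle into `ℂ`. -/
def universalUnitary : unitary UniversalUnitaryAlgebra :=
  ⟨⟨fun z : Circle => (z : ℂ), by fun_prop⟩, by
    rw [Unitary.mem_iff]
    constructor <;> refine ContinuousMap.ext fun z => ?_
    · exact (Complex.normSq_eq_conj_mul_self (z := (z : ℂ))).symm.trans (by simp)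
    · exact (Complex.mul_conj (z : ℂ)).trans (by simp)⟩

/-- The universal property: a unitary `v` of any unital C⋆-algebra, in any universe, is the image
of the universal unitary under exactly one unital ⋆-homomorphism. -/
theorem existsUnique_universalUnitary_lift {D : Type*} [CStarAlgebra D] (v : unitary D) :
    ∃! φ : UniversalUnitaryAlgebra →⋆ₐ[ℂ] D, φ universalUnitary = v := by
  have hn : IsStarNormal (v : D) := by infer_instance
  have hs : ∀ z : spectrum ℂ (v : D), (z : ℂ) ∈ Submonoid.unitSphere ℂ := fun z =>
    spectrum.subset_circle_of_unitary v.2 z.2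
  let j : C(spectrum ℂ (v : D), Circle) := ⟨fun z => ⟨z, hs z⟩, by fun_prop⟩
  have h1 : (cfcHom hn).comp (j.compStarAlgHom' ℂ ℂ) universalUnitary = (v : D) := by
    have : (j.compStarAlgHom' ℂ ℂ) (universalUnitary : UniversalUnitaryAlgebra)
        = (ContinuousMap.id ℂ).restrict (spectrum ℂ (v : D)) := by
      ext z; rfl
    simp only [StarAlgHom.comp_apply, this]
    exact cfcHom_id hn
  suffices h : ∀ φ ψ : UniversalUnitaryAlgebra →⋆ₐ[ℂ] D,
      φ universalUnitary = v → ψ universalUnitary = v → φ = ψ from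
    ⟨_, h1, fun ψ hψ => h _ _ hψ h1⟩
  have hc : ∀ φ : UniversalUnitaryAlgebra →⋆ₐ[ℂ] D, Continuous φ := fun φ =>
    AddMonoidHomClass.continuous_of_bound φ 1 fun f => by
      simpa using NonUnitalStarAlgHom.norm_apply_le φ f
  intro φ ψ hφ hψ
  have hcl : IsClosed (StarAlgHom.equalizer φ ψ : Set UniversalUnitaryAlgebra) :=
    isClosed_eq (hc φ) (hc ψ)
  have hsep : (StarAlgHom.equalizer φ ψ).SeparatesPoints := by
    intro z w hzw
    refine ⟨_, ⟨universalUnitary, ?_, rfl⟩, ?_⟩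
    · exact hφ.trans hψ.symm
    · exact fun h => hzw (Circle.ext h)
  have htop := ContinuousMap.starSubalgebra_topologicalClosure_eq_top_of_separatesPoints _ hsep
  have hle := StarSubalgebra.topologicalClosure_minimal le_rfl hcl
  rw [htop] at hle
  exact StarAlgHom.ext fun f => hle (StarSubalgebra.mem_top (x := f))

end

universe u v

noncomputable section

/-! ### Strict positivity and states -/

section States

variable {A : Type*} [CStarAlgebra A]

/-! A state `s` takes the value `1 + 2 Re (z s(x))` on the pencil `1 + z x + z̄ x⋆`, and states
detect positivity. Turning the phase of `s(x)` with `z`, and using compactness of the circle for a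
uniform margin, gives 1 ↔ 5. A matrix as in 6, compressed by the column `(1 ⊗ 1, 1 ⊗ v)`, yields 3
and 4; 3 gives 2 because `z v` is again unitary, and product states bring 2 and 4 back to `A`.

The substance is 5 → 6. A uniform bound `r ≤ 1 + z x + z̄ x⋆` makes the tridiagonal block Toeplitz
forms with diagonal `d = 1 - r/2` dominate `r/2` times the square of their first coordinate
(`toeplitzForm_nonneg`). Hence their Schur complements `c₀ = d`, `cₙ₊₁ = d - x cₙ⁻¹ x⋆` stay above
`r/2` (`smul_one_le_riccatiSeq`). The blocks with rows `(d - cₙ₊₁, x)` and `(x⋆, cₙ)` are then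
positive, and averaging them over `n < N` telescopes the diagonal sum to `d + (d - c_N)/N`, which is
below 1 for large `N`. A finite average suffices, so no limit of the `cₙ` is taken. -/

theorem isSelfAdjoint_pencil (x : A) (z : ℂ) :
    IsSelfAdjoint (1 + z • x + star z • star x) := by
  rw [IsSelfAdjoint, star_add, star_add, star_smul, star_smul, star_star, star_star, star_one]
  abel

variable [PartialOrder A]

theorem CStarState.map_real_smul_one (s : CStarState A) (r : ℝ) :
    s.1 (r • (1 : A)) = (r : ℂ) := by
  rw [← Complex.coe_smul, map_smul, s.2, smul_eq_mul, mul_one]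

theorem CStarState.ofReal_le_of_smul_one_le (s : CStarState A) {r : ℝ} {a : A}
    (h : r • (1 : A) ≤ a) : (r : ℂ) ≤ s.1 a := by
  rw [← s.map_real_smul_one]
  exact OrderHomClass.mono s.1 h

variable [StarOrderedRing A]

theorem exists_eq_star_mul_self_of_nonneg {a : A} (ha : 0 ≤ a) : ∃ u : A, a = star u * u :=
  CStarAlgebra.nonneg_iff_eq_star_mul_self.1 ha

theorem isStrictlyPositive_iff_exists_smul_one_le {a : A} :
    IsStrictlyPositive a ↔ ∃ r : ℝ, 0 < r ∧ r • (1 : A) ≤ a := by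
  simp_rw [← Algebra.algebraMap_eq_smul_one]
  constructor
  · intro ha
    rcases subsingleton_or_nontrivial A with hA | hA
    · exact ⟨1, one_pos, (Subsingleton.elim _ _).le⟩
    · exact (CFC.exists_pos_algebraMap_le_iff ha.isSelfAdjoint).2 fun x hx => ha.spectrum_pos hx
  · rintro ⟨r, hr, h⟩
    exact (isStrictlyPositive_algebraMap hr).of_le h

theorem CStarState.apply_star (s : CStarState A) (x : A) : s.1 (star x) = star (s.1 x) :=
  map_star s.1 x

open ComplexStarModule in
/-- States detect positivity of self-adjoint elements. -/
theorem nonneg_of_forall_state {y : A} (hy : IsSelfAdjoint y)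
    (h : ∀ s : CStarState A, 0 ≤ s.1 y) : 0 ≤ y := by
  by_contra hn
  -- Hahn–Banach: a real functional nonnegative on the closed positive cone and negative at `y`.
  obtain ⟨f, hf, hfy⟩ := (ProperCone.positive ℝ A).hyperplane_separation_point
    (x₀ := y) (by simpa using hn)
  replace hf : ∀ p : A, 0 ≤ p → 0 ≤ f p := fun p hp => hf p (by simpa using hp)
  -- At `a = y` this excludes `f 1 = 0`, so `f` can be normalised to a state.
  have bound : ∀ a : A, IsSelfAdjoint a → -(‖a‖ * f 1) ≤ f a := fun a ha => by
    have h1 : 0 ≤ a + ‖a‖ • (1 : A) := by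
      have := ha.neg_algebraMap_norm_le_self
      rw [Algebra.algebraMap_eq_smul_one] at this
      exact neg_le_iff_add_nonneg.1 this
    have := hf _ h1
    rw [map_add, map_smul, smul_eq_mul] at this
    linarith
  have h1 : 0 < f 1 := by
    rcases (hf 1 zero_le_one).lt_or_eq with h1 | h1
    · exact h1
    · have := bound y hy
      rw [← h1] at this
      linarith
  let F : Module.Dual ℝ A :=
    (f 1)⁻¹ • (f.toLinearMap ∘ₗ (selfAdjoint.submodule ℝ A).subtype ∘ₗ realPart)
  have hF : ∀ a, F a = (f 1)⁻¹ * f (ℜ a : A) := fun a => rfl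
  have hG : ∀ a : A, IsSelfAdjoint a →
      F.extendRCLike (𝕜 := ℂ) a = (((f 1)⁻¹ * f a : ℝ) : ℂ) := fun a ha => by
    have hI : F (Complex.I • a) = 0 := by
      rw [hF, realPart_I_smul, ha.imaginaryPart]
      simp
    rw [Module.Dual.extendRCLike_apply]
    simp only [RCLike.I_to_complex, hI]
    rw [hF, ha.coe_realPart]
    simp
  let s : CStarState A := ⟨PositiveLinearMap.mk₀ (F.extendRCLike (𝕜 := ℂ)) fun p hp => by
    rw [hG p (.of_nonneg hp), Complex.zero_le_real]
    exact mul_nonneg (inv_nonneg.2 h1.le) (hf p hp), by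
      change F.extendRCLike (𝕜 := ℂ) 1 = 1
      rw [hG 1 (.one A), inv_mul_cancel₀ h1.ne', Complex.ofReal_one]⟩
  have hs : s.1 y = (((f 1)⁻¹ * f y : ℝ) : ℂ) := hG y hy
  have := h s
  rw [hs, Complex.zero_le_real] at this
  exact absurd this (not_le.2 (mul_neg_of_pos_of_neg (inv_pos.2 h1) hfy))

/-- A self-adjoint element dominates a real scalar as soon as all states do. -/
theorem smul_one_le_of_forall_state {y : A} (hy : IsSelfAdjoint y) {r : ℝ}
    (h : ∀ s : CStarState A, (r : ℂ) ≤ s.1 y) : r • (1 : A) ≤ y := by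
  rw [← sub_nonneg]
  refine nonneg_of_forall_state (hy.sub ((IsSelfAdjoint.all r).smul (.one A))) fun s => ?_
  rw [map_sub, s.map_real_smul_one, sub_nonneg]
  exact h s

/-- The state given by a unit vector in a representation. -/
def vectorState {H : Type*} [NormedAddCommGroup H] [InnerProductSpace ℂ H] [CompleteSpace H]
    (ρ : A →⋆ₐ[ℂ] (H →L[ℂ] H)) (ξ : H) (hξ : inner ℂ ξ ξ = (1 : ℂ)) : CStarState A :=
  ⟨PositiveLinearMap.mk₀
    { toFun := fun a => inner ℂ ξ (ρ a ξ)
      map_add' := fun a b => by rw [map_add, add_apply, inner_add_right]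
      map_smul' := fun c a => by
        rw [map_smul, smul_apply, inner_smul_right, RingHom.id_apply, smul_eq_mul] }
    fun a ha => by
      obtain ⟨u, rfl⟩ := exists_eq_star_mul_self_of_nonneg ha
      change 0 ≤ inner ℂ ξ (ρ (star u * u) ξ)
      rw [map_mul, map_star, mul_apply_eq_comp, ContinuousLinearMap.star_eq_adjoint,
        ContinuousLinearMap.adjoint_inner_right]
      rw [inner_self_eq_norm_sq_to_K, ← RCLike.ofReal_pow]
      exact RCLike.ofReal_nonneg.2 (sq_nonneg _), by
    change inner ℂ ξ (ρ 1 ξ) = 1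
    rw [map_one, one_apply_eq_self, hξ]⟩

theorem vectorState_apply {H : Type*} [NormedAddCommGroup H] [InnerProductSpace ℂ H]
    [CompleteSpace H] (ρ : A →⋆ₐ[ℂ] (H →L[ℂ] H)) (ξ : H) (hξ : inner ℂ ξ ξ = (1 : ℂ)) (a : A) :
    (vectorState ρ ξ hξ).1 a = inner ℂ ξ (ρ a ξ) := rfl

/-! ### The numerical radius and the pencil `1 + z x + z̄ x⋆` -/

theorem CStarState.apply_pencil (s : CStarState A) (x : A) (z : ℂ) :
    s.1 (1 + z • x + star z • star x) = ((1 + 2 * (z * s.1 x).re : ℝ) : ℂ) := by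
  have h : star z * star (s.1 x) = star (z * s.1 x) := (star_mul' _ _).symm
  rw [map_add, map_add, map_smul, map_smul, s.apply_star, s.2, smul_eq_mul, smul_eq_mul, h,
    add_assoc, Complex.star_def, Complex.add_conj]
  push_cast
  ring

theorem isStrictlyPositive_pencil_of_numericalRadius_lt {x : A} (h : numericalRadius x < 1 / 2)
    (z : Circle) : IsStrictlyPositive (1 + (z : ℂ) • x + star (z : ℂ) • star x) := by
  refine isStrictlyPositive_iff_exists_smul_one_le.2
    ⟨1 - 2 * numericalRadius x, by linarith, ?_⟩
  refine smul_one_le_of_forall_state (isSelfAdjoint_pencil x z) fun s => ?_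
  rw [s.apply_pencil, Complex.real_le_real]
  have h1 : ‖s.1 x‖ ≤ numericalRadius x := le_ciSup (bddAbove_norm_state x) s
  have h2 := (abs_le.1 (Complex.abs_re_le_norm ((z : ℂ) * s.1 x))).1
  rw [norm_mul, Circle.norm_coe, one_mul] at h2
  linarith

/-- By norm continuity a margin at `z₀` survives, halved, on a neighbourhood; compactness leaves a
minimum of finitely many margins. -/
theorem exists_uniform_le_pencil {x : A}
    (h : ∀ z : Circle, IsStrictlyPositive (1 + (z : ℂ) • x + star (z : ℂ) • star x)) :
    ∃ r : ℝ, 0 < r ∧ ∀ z : Circle, r • (1 : A) ≤ 1 + (z : ℂ) • x + star (z : ℂ) • star x := by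
  suffices H : ∃ r : ℝ, 0 < r ∧ ∀ z ∈ (Set.univ : Set Circle),
      r • (1 : A) ≤ 1 + (z : ℂ) • x + star (z : ℂ) • star x by simpa using H
  refine isCompact_univ.induction_on (p := fun S : Set Circle => ∃ r : ℝ, 0 < r ∧ ∀ z ∈ S,
      r • (1 : A) ≤ 1 + (z : ℂ) • x + star (z : ℂ) • star x) ⟨1, one_pos, by simp⟩ ?_ ?_ ?_
  · rintro S T hST ⟨r, hr, hT⟩
    exact ⟨r, hr, fun z hz => hT z (hST hz)⟩
  · rintro S T ⟨r, hr, hS⟩ ⟨t, ht, hT⟩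
    refine ⟨min r t, lt_min hr ht, ?_⟩
    rintro z (hz | hz)
    · exact (smul_le_smul_of_nonneg_right (min_le_left _ _) zero_le_one).trans (hS z hz)
    · exact (smul_le_smul_of_nonneg_right (min_le_right _ _) zero_le_one).trans (hT z hz)
  · intro z₀ _
    obtain ⟨r, hr, hz₀⟩ := isStrictlyPositive_iff_exists_smul_one_le.1 (h z₀)
    let P : Circle → A := fun z => 1 + (z : ℂ) • x + star (z : ℂ) • star x
    have hP : Continuous P := by fun_prop
    have hmem : {z | ‖P z - P z₀‖ < r / 2} ∈ nhdsWithin z₀ Set.univ := by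
      rw [nhdsWithin_univ]
      exact (isOpen_lt (by fun_prop) continuous_const).mem_nhds (by simpa using half_pos hr)
    refine ⟨_, hmem, r / 2, half_pos hr, fun z hz => ?_⟩
    have hd := ((isSelfAdjoint_pencil x z).sub
      (isSelfAdjoint_pencil x z₀)).neg_algebraMap_norm_le_self
    rw [Algebra.algebraMap_eq_smul_one] at hd
    calc (r / 2) • (1 : A) = r • (1 : A) + -((r / 2) • (1 : A)) := by
          rw [← sub_eq_add_neg, ← sub_smul]; ring_nf
      _ ≤ P z₀ + (P z - P z₀) := by
          refine add_le_add hz₀ (le_trans (neg_le_neg ?_) hd)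
          exact smul_le_smul_of_nonneg_right (le_of_lt hz) zero_le_one
      _ = P z := add_sub_cancel _ _

theorem numericalRadius_lt_of_isStrictlyPositive_pencil {x : A}
    (h : ∀ z : Circle, IsStrictlyPositive (1 + (z : ℂ) • x + star (z : ℂ) • star x)) :
    numericalRadius x < 1 / 2 := by
  obtain ⟨r, hr, hP⟩ := exists_uniform_le_pencil h
  have key : ∀ s : CStarState A, ‖s.1 x‖ ≤ (1 - r) / 2 := fun s => by
    -- The worst phase: the pencil then has value `1 - 2 ‖s x‖`.
    obtain ⟨z, hz⟩ : ∃ z : Circle, (z : ℂ) * s.1 x = -(‖s.1 x‖ : ℂ) := by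
      refine ⟨-(Circle.exp (Complex.arg (s.1 x)))⁻¹, ?_⟩
      have h0 := Complex.norm_mul_exp_arg_mul_I (s.1 x)
      rw [← Circle.coe_exp] at h0
      nth_rewrite 2 [← h0]
      have := (Circle.exp (Complex.arg (s.1 x))).coe_ne_zero
      simp only [Circle.coe_neg, Circle.coe_inv]
      field_simp
    have := s.ofReal_le_of_smul_one_le (hP z)
    rw [s.apply_pencil, Complex.real_le_real, hz, Complex.neg_re, Complex.ofReal_re] at this
    linarith
  rcases isEmpty_or_nonempty (CStarState A) with hs | hs
  · rw [numericalRadius, Real.iSup_of_isEmpty]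
    norm_num
  · exact (ciSup_le key).trans_lt (by linarith)

end States

/-! ### Product states of the minimal tensor product -/

section ProductState

variable {A : Type*} [CStarAlgebra A] [PartialOrder A] [StarOrderedRing A]
  {B : Type*} [CStarAlgebra B] [PartialOrder B] [StarOrderedRing B]

open Classical in
/-- The cyclic vector of the GNS representation of a state, in the universal representation. -/
def CStarState.vector (s : CStarState A) : UniversalSpace A :=
  lp.single 2 s ((s.1.toPreGNS 1 : s.1.PreGNS) : s.1.GNS)

/-- This makes product states available without an extension argument: they are vector states at
tensors of cyclic vectors. -/
theorem CStarState.inner_vector (s : CStarState A) (a : A) :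
    inner ℂ s.vector (universalRep A a s.vector) = s.1 a := by
  classical
  rw [CStarState.vector, lp.inner_single_left]
  have : (universalRep A a (lp.single 2 s ((s.1.toPreGNS 1 : s.1.PreGNS) : s.1.GNS))) s
      = s.1.gnsStarAlgHom a ((s.1.toPreGNS 1 : s.1.PreGNS) : s.1.GNS) := by
    simp [universalRep, directSumRep]
  rw [this]
  simp [PositiveLinearMap.preGNS_inner_def]

/-- The inclusion of the minimal tensor product into the bounded operators. -/
def MinTensor.toOperator (A B : Type*) [CStarAlgebra A] [PartialOrder A] [StarOrderedRing A]
    [CStarAlgebra B] [PartialOrder B] [StarOrderedRing B] :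
    MinTensor A B →⋆ₐ[ℂ] (HilbertTensor (UniversalSpace A) (UniversalSpace B) →L[ℂ]
      HilbertTensor (UniversalSpace A) (UniversalSpace B)) :=
  StarSubalgebra.subtype (tensorRep (universalRep A) (universalRep B)).range.topologicalClosure

theorem MinTensor.toOperator_tmul (a : A) (b : B) :
    MinTensor.toOperator A B (MinTensor.tmul a b)
      = opTensor (universalRep A a) (universalRep B b) := by
  change tensorRep (universalRep A) (universalRep B) (a ⊗ₜ b) = _
  simp [tensorRep, opTensorₗ]

theorem MinTensor.tmul_one_one : MinTensor.tmul (1 : A) (1 : B) = 1 :=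
  map_one (MinTensor.ofTensor A B)

theorem MinTensor.tmul_smul (a : A) (z : ℂ) (b : B) :
    MinTensor.tmul a (z • b) = z • MinTensor.tmul a b := by
  rw [MinTensor.tmul, TensorProduct.tmul_smul, map_smul, MinTensor.tmul]

theorem MinTensor.star_tmul (a : A) (b : B) :
    star (MinTensor.tmul a b) = MinTensor.tmul (star a) (star b) := by
  rw [MinTensor.tmul, ← map_star, TensorProduct.star_tmul, MinTensor.tmul]

theorem CStarState.inner_vector_self (s : CStarState A) : inner ℂ s.vector s.vector = (1 : ℂ) := by
  have h := s.inner_vector 1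
  rwa [map_one, one_apply_eq_self, s.2] at h

/-- The product of two states, a state of the minimal tensor product. -/
def CStarState.tensor (s : CStarState A) (t : CStarState B) : CStarState (MinTensor A B) :=
  vectorState (MinTensor.toOperator A B)
    (HilbertTensor.incl (UniversalSpace A) (UniversalSpace B) (s.vector ⊗ₜ t.vector)) <| by
      rw [HilbertTensor.inner_incl, TensorProduct.inner_tmul, s.inner_vector_self,
        t.inner_vector_self, mul_one]

theorem CStarState.tensor_tmul (s : CStarState A) (t : CStarState B) (a : A) (b : B) :
    (s.tensor t).1 (MinTensor.tmul a b) = s.1 a * t.1 b := by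
  rw [CStarState.tensor, vectorState_apply, MinTensor.toOperator_tmul, opTensor_incl,
    HilbertTensor.inner_incl, TensorProduct.mapL_tmul, TensorProduct.inner_tmul, s.inner_vector,
    t.inner_vector]

/-- Evaluation at a point as a state of `C(X, ℂ)`. -/
def evalState {X : Type*} [TopologicalSpace X] [CompactSpace X] (p : X) : CStarState C(X, ℂ) :=
  ⟨PositiveLinearMap.mk₀ (ContinuousMap.evalStarAlgHom ℂ ℂ p).toAlgHom.toLinearMap
    fun _ hf => hf p, rfl⟩

/-- A state of `B` on which `b` takes the value `1` transports the numerical radius. -/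
theorem numericalRadius_le_numericalRadius_tmul (x : A) {b : B} {t : CStarState B}
    (ht : t.1 b = 1) : numericalRadius x ≤ numericalRadius (MinTensor.tmul x b) := by
  refine Real.iSup_le (fun s => ?_) (Real.iSup_nonneg fun _ => norm_nonneg _)
  have := le_ciSup (bddAbove_norm_state (MinTensor.tmul x b)) (s.tensor t)
  rwa [s.tensor_tmul, ht, mul_one] at this

/-- The slice map `id ⊗ t` would carry the lower bound over to `A`; testing on all product states `s
⊗ t` has the same effect. -/
theorem isStrictlyPositive_pencil_of_tmul {x : A} {b : B}
    (h : IsStrictlyPositive (MinTensor.tmul (1 : A) (1 : B) + MinTensor.tmul x b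
      + MinTensor.tmul (star x) (star b))) (t : CStarState B) :
    IsStrictlyPositive (1 + t.1 b • x + star (t.1 b) • star x) := by
  obtain ⟨r, hr, hle⟩ := isStrictlyPositive_iff_exists_smul_one_le.1 h
  refine isStrictlyPositive_iff_exists_smul_one_le.2 ⟨r, hr, ?_⟩
  refine smul_one_le_of_forall_state (isSelfAdjoint_pencil x _) fun s => ?_
  have key := (s.tensor t).ofReal_le_of_smul_one_le hle
  rwa [map_add, map_add, s.tensor_tmul, s.tensor_tmul, s.tensor_tmul, t.2, mul_one, t.apply_star,
    mul_comm (s.1 x), mul_comm (s.1 (star x)), ← smul_eq_mul, ← smul_eq_mul, ← map_smul,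
    ← map_smul, ← map_add, ← map_add] at key

theorem isStrictlyPositive_pencil_of_tmul_universalUnitary {x : A}
    (h : IsStrictlyPositive (MinTensor.tmul (1 : A) (1 : UniversalUnitaryAlgebra)
        + MinTensor.tmul x (universalUnitary : UniversalUnitaryAlgebra)
        + MinTensor.tmul (star x) (star (universalUnitary : UniversalUnitaryAlgebra))))
    (z : Circle) : IsStrictlyPositive (1 + (z : ℂ) • x + star (z : ℂ) • star x) :=
  isStrictlyPositive_pencil_of_tmul h (evalState z)

end ProductState

/-! ### Block matrices -/

section BlockMatrix

variable {A : Type*} [CStarAlgebra A] [PartialOrder A] [StarOrderedRing A]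

/-- Subtract a scalar margin and write the rest as `N⋆ N`. The entrywise form passes to tensor
products without matrices over them. -/
theorem exists_factorization_of_isStrictlyPositive {a b x : A}
    (h : IsStrictlyPositive (CStarMatrix.ofMatrix !![a, x; star x, b])) :
    ∃ ε : ℝ, 0 < ε ∧ ∃ p q r t : A, a = ε • (1 : A) + (star p * p + star q * q) ∧
      x = star p * r + star q * t ∧ b = ε • (1 : A) + (star r * r + star t * t) := by
  obtain ⟨ε, hε, hle⟩ := isStrictlyPositive_iff_exists_smul_one_le.1 h
  obtain ⟨N, hN⟩ := exists_eq_star_mul_self_of_nonneg (sub_nonneg.2 hle)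
  have entry : ∀ i j, (CStarMatrix.ofMatrix !![a, x; star x, b]) i j
      = ε • (1 : CStarMatrix (Fin 2) (Fin 2) A) i j
        + (star (N 0 i) * N 0 j + star (N 1 i) * N 1 j) := fun i j => by
    have := congrArg (fun M : CStarMatrix (Fin 2) (Fin 2) A => M i j) (sub_eq_iff_eq_add'.1 hN)
    refine this.trans (congrArg (ε • (1 : CStarMatrix (Fin 2) (Fin 2) A) i j + ·) ?_)
    rw [CStarMatrix.mul_apply, Fin.sum_univ_two, CStarMatrix.star_apply, CStarMatrix.star_apply]
  refine ⟨ε, hε, N 0 0, N 1 0, N 0 1, N 1 1, ?_, ?_, ?_⟩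
  · simpa using entry 0 0
  · simpa using entry 0 1
  · simpa using entry 1 1

theorem isStrictlyPositive_tmul_of_blockMatrix {B : Type*} [CStarAlgebra B] [PartialOrder B]
    [StarOrderedRing B] {a b x : A} (hab : a + b = 1)
    (h : IsStrictlyPositive (CStarMatrix.ofMatrix !![a, x; star x, b])) (v : unitary B) :
    IsStrictlyPositive (MinTensor.tmul (1 : A) (1 : B) + MinTensor.tmul x (v : B)
      + MinTensor.tmul (star x) (star (v : B))) := by
  obtain ⟨ε, hε, p, q, r, t, ha, hx, hb⟩ := exists_factorization_of_isStrictlyPositive h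
  -- `g` and `k` are the entries of `(N ⊗ 1) V` for the column `V = (1 ⊗ 1, 1 ⊗ v)`; since `V⋆ V =
  -- 2`, the margin becomes `2 ε`.
  let g : A ⊗[ℂ] B := p ⊗ₜ 1 + r ⊗ₜ (v : B)
  let k : A ⊗[ℂ] B := q ⊗ₜ 1 + t ⊗ₜ (v : B)
  have hv : star (v : B) * v = 1 := Unitary.coe_star_mul_self v
  have key : (1 : A) ⊗ₜ[ℂ] (1 : B) + x ⊗ₜ[ℂ] (v : B) + star x ⊗ₜ[ℂ] star (v : B)
      = ((2 * ε : ℝ) : ℂ) • (1 : A ⊗[ℂ] B) + (star g * g + star k * k) := by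
    have h1 : ((2 * ε : ℝ) : ℂ) • (1 : A ⊗[ℂ] B) = ((2 * ε : ℝ) • (1 : A)) ⊗ₜ[ℂ] (1 : B) := by
      rw [Algebra.TensorProduct.one_def, TensorProduct.smul_tmul', Complex.coe_smul]
    rw [h1]
    nth_rewrite 1 [← hab]
    rw [ha, hb, hx]
    simp only [g, k, star_add, TensorProduct.star_tmul, star_one, star_mul, star_star, mul_add,
      add_mul, Algebra.TensorProduct.tmul_mul_tmul, TensorProduct.add_tmul, mul_one, one_mul, hv,
      two_mul, add_smul]
    abel
  have h2 : MinTensor.tmul (1 : A) (1 : B) + MinTensor.tmul x (v : B)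
      + MinTensor.tmul (star x) (star (v : B)) = (2 * ε : ℝ) • (1 : MinTensor A B)
        + (star (MinTensor.ofTensor A B g) * MinTensor.ofTensor A B g
          + star (MinTensor.ofTensor A B k) * MinTensor.ofTensor A B k) := by
    simp only [MinTensor.tmul, ← map_add, key, ← map_star, ← map_mul]
    rw [map_add, map_smul, map_one, Complex.coe_smul]
  rw [h2]
  exact isStrictlyPositive_iff_exists_smul_one_le.2 ⟨2 * ε, by positivity,
    le_add_of_nonneg_right (add_nonneg (star_mul_self_nonneg _) (star_mul_self_nonneg _))⟩

theorem blockDiagonal_nonneg {p q : A} (hp : 0 ≤ p) (hq : 0 ≤ q) :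
    0 ≤ CStarMatrix.ofMatrix !![p, 0; 0, q] := by
  obtain ⟨u, rfl⟩ := exists_eq_star_mul_self_of_nonneg hp
  obtain ⟨w, rfl⟩ := exists_eq_star_mul_self_of_nonneg hq
  have h : CStarMatrix.ofMatrix !![star u * u, 0; 0, star w * w]
      = star (CStarMatrix.ofMatrix !![u, 0; 0, w]) * CStarMatrix.ofMatrix !![u, 0; 0, w] := by
    ext i j
    fin_cases i <;> fin_cases j <;> simp [CStarMatrix.mul_apply, CStarMatrix.star_apply]
  rw [h]
  exact star_mul_self_nonneg _

open Ring in
-- The matrix is congruent to `diag(0, c)` through a lower triangular factor.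
theorem schurBlock_nonneg {c : A} (hc : IsStrictlyPositive c) (x : A) :
    0 ≤ CStarMatrix.ofMatrix !![x * c⁻¹ʳ * star x, x; star x, c] := by
  obtain ⟨c, rfl⟩ := hc.isUnit
  rw [Ring.inverse_unit]
  have hs : star (↑c⁻¹ : A) = ↑c⁻¹ := by
    rw [← Units.coe_star, star_inv, show star c = c from Units.ext hc.isSelfAdjoint.star_eq]
  have h : CStarMatrix.ofMatrix !![x * ↑c⁻¹ * star x, x; star x, (c : A)]
      = star (CStarMatrix.ofMatrix !![1, 0; ↑c⁻¹ * star x, 1])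
        * CStarMatrix.ofMatrix !![0, 0; 0, (c : A)]
        * CStarMatrix.ofMatrix !![1, 0; ↑c⁻¹ * star x, 1] := by
    ext i j
    fin_cases i <;> fin_cases j <;>
      simp [CStarMatrix.mul_apply, CStarMatrix.star_apply, hs, mul_assoc]
  rw [h]
  exact star_left_conjugate_nonneg (blockDiagonal_nonneg le_rfl hc.nonneg) _

end BlockMatrix

/-! ### Block Toeplitz forms -/

/-- Orthogonality of roots of unity: a finite average that replaces integration over the circle for
low frequencies. -/
theorem Circle.exists_sum_zpow_eq_ite (N : ℕ) (hN : N ≠ 0) :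
    ∃ ω : Circle, ∀ m : ℤ, |m| < N →
      ∑ k ∈ Finset.range N, (((ω ^ k) ^ m : Circle) : ℂ) = if m = 0 then (N : ℂ) else 0 := by
  have hω : ((Circle.exp (2 * Real.pi / N) : Circle) : ℂ)
      = Complex.exp (2 * Real.pi * Complex.I / N) := by
    rw [Circle.coe_exp]
    congr 1
    push_cast
    ring
  have hprim := Complex.isPrimitiveRoot_exp N hN
  rw [← hω] at hprim
  refine ⟨Circle.exp (2 * Real.pi / N), fun m hm => ?_⟩
  set ω := Circle.exp (2 * Real.pi / N)
  split_ifs with h0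
  · simp [h0]
  · have h1 : ((ω ^ m : Circle) : ℂ) ≠ 1 := by
      rw [Circle.coe_zpow, Ne, hprim.zpow_eq_one_iff_dvd]
      exact fun hd => h0 (Int.eq_zero_of_abs_lt_dvd hd hm)
    have h2 : ((ω ^ m : Circle) : ℂ) ^ N = 1 := by
      rw [Circle.coe_zpow, ← zpow_natCast, ← zpow_mul, mul_comm, zpow_mul, zpow_natCast,
        hprim.pow_eq_one, one_zpow]
    have h3 : ∀ k : ℕ, (((ω ^ k) ^ m : Circle) : ℂ) = ((ω ^ m : Circle) : ℂ) ^ k := fun k => by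
      rw [← Circle.coe_pow, ← zpow_natCast, ← zpow_natCast, ← zpow_mul, ← zpow_mul, mul_comm]
    simp_rw [h3]
    have := mul_geom_sum ((ω ^ m : Circle) : ℂ) N
    rw [h2, sub_self] at this
    exact (mul_eq_zero.1 this).resolve_left (sub_ne_zero.2 h1)

theorem Finset.sum_range_succ_ite_superdiagonal {M : Type*} [AddCommMonoid M] (f : ℕ → ℕ → M)
    (n : ℕ) : ∑ i ∈ range (n + 1), ∑ j ∈ range (n + 1), (if j = i + 1 then f i j else 0)
      = ∑ i ∈ range n, f i (i + 1) := by
  rw [sum_range_succ]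
  simp only [sum_ite_eq', mem_range, Nat.add_lt_add_iff_right, lt_irrefl, if_false, add_zero]
  exact sum_congr rfl fun i hi => if_pos (mem_range.1 hi)

section Toeplitz

variable {A : Type*} [CStarAlgebra A]

theorem star_mul_mul_of_trigPolynomial (m : A) (ξ : ℕ → A) (n : ℕ) (z : Circle) :
    star (∑ i ∈ Finset.range n, ((z ^ i : Circle) : ℂ) • ξ i) * m
        * (∑ i ∈ Finset.range n, ((z ^ i : Circle) : ℂ) • ξ i)
      = ∑ i ∈ Finset.range n, ∑ j ∈ Finset.range n,
          ((z ^ ((j : ℤ) - i) : Circle) : ℂ) • (star (ξ i) * m * ξ j) := by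
  rw [star_sum, Finset.sum_mul, Finset.sum_mul_sum]
  refine Finset.sum_congr rfl fun i _ => Finset.sum_congr rfl fun j _ => ?_
  have : ((z ^ ((j : ℤ) - i) : Circle) : ℂ)
      = star ((z ^ i : Circle) : ℂ) * ((z ^ j : Circle) : ℂ) := by
    rw [Complex.star_def, ← Circle.coe_inv_eq_conj, ← Circle.coe_mul, zpow_sub, zpow_natCast,
      zpow_natCast, mul_comm]
  rw [this, star_smul, smul_mul_assoc, smul_mul_assoc, mul_smul_comm, smul_smul]

theorem smul_star_mul_mul_of_trigPolynomial (m : A) (ξ : ℕ → A) (n : ℕ) (z : Circle) (e : ℤ) :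
    star (∑ i ∈ Finset.range n, ((z ^ i : Circle) : ℂ) • ξ i) * (((z ^ e : Circle) : ℂ) • m)
        * (∑ i ∈ Finset.range n, ((z ^ i : Circle) : ℂ) • ξ i)
      = ∑ i ∈ Finset.range n, ∑ j ∈ Finset.range n,
          ((z ^ ((j : ℤ) - i + e) : Circle) : ℂ) • (star (ξ i) * m * ξ j) := by
  rw [star_mul_mul_of_trigPolynomial]
  refine Finset.sum_congr rfl fun i _ => Finset.sum_congr rfl fun j _ => ?_
  rw [mul_smul_comm, smul_mul_assoc, smul_smul, zpow_add, Circle.coe_mul]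

/-- The quadratic form of the tridiagonal block Toeplitz matrix of size `n + 1` with diagonal
entries `d` and off-diagonal entries `x` and `star x`. -/
def toeplitzForm (x : A) (d : ℝ) (n : ℕ) (ξ : ℕ → A) : A :=
  ∑ i ∈ Finset.range (n + 1), d • (star (ξ i) * ξ i)
    + ∑ i ∈ Finset.range n,
        (star (ξ i) * x * ξ (i + 1) + star (ξ (i + 1)) * star x * ξ i)

theorem toeplitzForm_succ (x : A) (d : ℝ) (n : ℕ) (ξ : ℕ → A) :
    toeplitzForm x d (n + 1) ξ = d • (star (ξ 0) * ξ 0)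
      + (star (ξ 0) * x * ξ 1 + star (ξ 1) * star x * ξ 0)
      + toeplitzForm x d n fun i => ξ (i + 1) := by
  rw [toeplitzForm, toeplitzForm, Finset.sum_range_succ' _ (n + 1),
    Finset.sum_range_succ'
      (fun i => star (ξ i) * x * ξ (i + 1) + star (ξ (i + 1)) * star x * ξ i) n]
  abel

theorem toeplitzForm_add (x : A) (d e : ℝ) (n : ℕ) (ξ : ℕ → A) :
    toeplitzForm x (d + e) n ξ
      = toeplitzForm x d n ξ + e • ∑ i ∈ Finset.range (n + 1), star (ξ i) * ξ i := by
  simp only [toeplitzForm, add_smul, Finset.sum_add_distrib, Finset.smul_sum]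
  abel

variable [PartialOrder A] [StarOrderedRing A]

/-- The form is the zeroth Fourier coefficient of the pencil conjugated by the trigonometric
polynomial `∑ zⁱ ξᵢ`, hence an average of positive elements. -/
theorem toeplitzForm_nonneg {x : A} {e : ℝ}
    (h : ∀ z : Circle, 0 ≤ e • (1 : A) + (z : ℂ) • x + star (z : ℂ) • star x) (n : ℕ)
    (ξ : ℕ → A) : 0 ≤ toeplitzForm x e n ξ := by
  -- The frequencies `j - i + e` with `i, j ≤ n` and `|e| ≤ 1` are at most `n + 1` in absolute
  -- value.
  obtain ⟨ω, hω⟩ := Circle.exists_sum_zpow_eq_ite (n + 2) (by omega)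
  have avg : ∀ (m : A) (e : ℤ), |e| ≤ 1 →
      ∑ k ∈ Finset.range (n + 2), ∑ i ∈ Finset.range (n + 1), ∑ j ∈ Finset.range (n + 1),
          (((ω ^ k) ^ ((j : ℤ) - i + e) : Circle) : ℂ) • (star (ξ i) * m * ξ j)
        = ((n + 2 : ℕ) : ℂ) • ∑ i ∈ Finset.range (n + 1), ∑ j ∈ Finset.range (n + 1),
          if (j : ℤ) - i + e = 0 then star (ξ i) * m * ξ j else 0 := fun m e he => by
    rw [Finset.sum_comm, Finset.smul_sum]
    refine Finset.sum_congr rfl fun i hi => ?_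
    rw [Finset.sum_comm, Finset.smul_sum]
    refine Finset.sum_congr rfl fun j hj => ?_
    rw [Finset.mem_range] at hi hj
    rw [← Finset.sum_smul, hω _ (by rw [abs_lt]; rw [abs_le] at he; push_cast; omega)]
    split_ifs <;> simp
  have hsum : 0 ≤ ∑ k ∈ Finset.range (n + 2),
      star (∑ i ∈ Finset.range (n + 1), (((ω ^ k) ^ i : Circle) : ℂ) • ξ i)
        * (((((ω ^ k) ^ (0 : ℤ) : Circle) : ℂ) • (e • (1 : A)))
          + (((ω ^ k) ^ (-1 : ℤ) : Circle) : ℂ) • x + (((ω ^ k) ^ (1 : ℤ) : Circle) : ℂ) • star x)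
        * (∑ i ∈ Finset.range (n + 1), (((ω ^ k) ^ i : Circle) : ℂ) • ξ i) := by
    refine Finset.sum_nonneg fun k _ => star_left_conjugate_nonneg ?_ _
    -- The inverse gives `x` the frequency `-1`, which selects the superdiagonal `j = i + 1`.
    have := h (ω ^ k)⁻¹
    rw [Complex.star_def, ← Circle.coe_inv_eq_conj, inv_inv, ← zpow_neg_one] at this
    rwa [zpow_zero, zpow_one, Circle.coe_one, one_smul]
  simp only [mul_add, add_mul, smul_star_mul_mul_of_trigPolynomial, Finset.sum_add_distrib] at hsum
  rw [avg _ _ (by simp), avg _ _ (by simp), avg _ _ (by simp), ← smul_add, ← smul_add] at hsum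
  have hN : (0 : ℝ) < (n + 2 : ℕ) := by positivity
  rw [← Complex.ofReal_natCast, Complex.coe_smul] at hsum
  replace hsum := smul_nonneg (inv_nonneg.2 hN.le) hsum
  rw [inv_smul_smul₀ hN.ne'] at hsum
  rw [toeplitzForm, Finset.sum_add_distrib, ← add_assoc]
  refine hsum.trans_eq (congrArg₂ _ (congrArg₂ _ ?_ ?_) ?_)
  · refine Finset.sum_congr rfl fun i hi => ?_
    have hij : ∀ j : ℕ, (j : ℤ) - i + 0 = 0 ↔ j = i := by omega
    simp_rw [hij]
    rw [Finset.sum_ite_eq', if_pos hi, mul_smul_comm, mul_one, smul_mul_assoc]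
  · have hij : ∀ i j : ℕ, (j : ℤ) - i + -1 = 0 ↔ j = i + 1 := by omega
    simp_rw [hij]
    exact Finset.sum_range_succ_ite_superdiagonal (fun i j => star (ξ i) * x * ξ j) n
  · have hij : ∀ i j : ℕ, (j : ℤ) - i + 1 = 0 ↔ i = j + 1 := by omega
    simp_rw [hij]
    rw [Finset.sum_comm]
    exact Finset.sum_range_succ_ite_superdiagonal (fun j i => star (ξ i) * star x * ξ j) n

/-! ### The Riccati iteration -/

open Ring

/-- The iteration `a ↦ d - x a⁻¹ x⋆`, started at `d`: the Schur complements of the tridiagonal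
block Toeplitz matrices. -/
def riccatiSeq (x : A) (d : ℝ) : ℕ → A
  | 0 => d • 1
  | n + 1 => d • 1 - x * (riccatiSeq x d n)⁻¹ʳ * star x

/-- The Schur complement is the value of the form once the later coordinates complete the square, so
a lower bound for the form passes to it. -/
theorem smul_one_le_riccatiSeq {x : A} {d δ : ℝ} (hδ : 0 < δ)
    (h : ∀ n ξ, δ • (star (ξ 0) * ξ 0) ≤ toeplitzForm x d n ξ) (n : ℕ) :
    δ • (1 : A) ≤ riccatiSeq x d n := by
  -- Only `η = 1` matters here, but the induction needs every first coordinate.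
  have of_value : ∀ n, (∀ η, ∃ ξ : ℕ → A, ξ 0 = η ∧
      toeplitzForm x d n ξ = star η * riccatiSeq x d n * η) → δ • (1 : A) ≤ riccatiSeq x d n := by
    intro n hn
    obtain ⟨ξ, h0, hξ⟩ := hn 1
    simpa [h0, hξ] using h n ξ
  refine of_value n ?_
  induction n with
  | zero => exact fun η => ⟨fun _ => η, rfl, by simp [toeplitzForm, riccatiSeq]⟩
  | succ n ih =>
    intro η
    have hc : IsStrictlyPositive (riccatiSeq x d n) :=
      isStrictlyPositive_iff_exists_smul_one_le.2 ⟨δ, hδ, of_value n ih⟩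
    obtain ⟨c, hcu⟩ := hc.isUnit
    have hs : star (↑c⁻¹ : A) = ↑c⁻¹ := by
      rw [← Units.coe_star, star_inv,
        show star c = c from Units.ext (by rw [Units.coe_star, hcu, hc.isSelfAdjoint.star_eq])]
    -- The next coordinate that completes the square.
    obtain ⟨ξ, h0, hξ⟩ := ih (-(↑c⁻¹ * star x * η))
    refine ⟨fun i => Nat.casesOn i η ξ, rfl, ?_⟩
    rw [toeplitzForm_succ]
    change d • (star η * η) + (star η * x * ξ 0 + star (ξ 0) * star x * η)
      + toeplitzForm x d n ξ = _
    rw [hξ, h0, riccatiSeq, ← hcu, Ring.inverse_unit]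
    simp only [star_neg, star_mul, star_star, hs, mul_sub, sub_mul, mul_neg, neg_mul, neg_neg,
      mul_assoc, Units.inv_mul_cancel_left, mul_smul_comm, smul_mul_assoc, one_mul]
    abel

/-- This is the sum of the Schur blocks of `c₀, …, c_{N-1}`: as `x cₙ⁻¹ x⋆ = d - cₙ₊₁` and `c₀ = d`,
the upper corner telescopes. -/
theorem riccati_blockMatrix_nonneg {x : A} {d δ : ℝ} (hδ : 0 < δ)
    (h : ∀ n, δ • (1 : A) ≤ riccatiSeq x d n) (N : ℕ) :
    0 ≤ CStarMatrix.ofMatrix !![(N * d) • (1 : A) + d • (1 : A) - riccatiSeq x d N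
        - ∑ n ∈ Finset.range N, riccatiSeq x d n, (N : ℝ) • x;
      (N : ℝ) • star x, ∑ n ∈ Finset.range N, riccatiSeq x d n] := by
  induction N with
  | zero =>
    have : CStarMatrix.ofMatrix !![((0 : ℕ) * d) • (1 : A) + d • (1 : A) - riccatiSeq x d 0
        - ∑ n ∈ Finset.range 0, riccatiSeq x d n, ((0 : ℕ) : ℝ) • x;
      ((0 : ℕ) : ℝ) • star x, ∑ n ∈ Finset.range 0, riccatiSeq x d n] = 0 := by
      ext i j
      fin_cases i <;> fin_cases j <;> simp [riccatiSeq]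
    exact this.ge
  | succ N ih =>
    have hc : IsStrictlyPositive (riccatiSeq x d N) :=
      isStrictlyPositive_iff_exists_smul_one_le.2 ⟨δ, hδ, h N⟩
    refine (add_nonneg ih (schurBlock_nonneg hc x)).trans_eq ?_
    rw [CStarMatrix.of_add_of]
    congr 1
    ext i j
    fin_cases i <;> fin_cases j
    · simp [riccatiSeq, Finset.sum_range_succ, add_smul, add_mul]
      abel
    · simp [add_smul]
    · simp [add_smul]
    · simp [Finset.sum_range_succ]

theorem exists_blockMatrix_of_uniform_le_pencil {x : A} {r : ℝ} (hr : 0 < r)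
    (h : ∀ z : Circle, r • (1 : A) ≤ 1 + (z : ℂ) • x + star (z : ℂ) • star x) :
    ∃ a b : A, IsStrictlyPositive a ∧ IsStrictlyPositive b ∧
      IsStrictlyPositive (CStarMatrix.ofMatrix !![a, x; star x, b]) ∧ a + b = 1 := by
  -- Half of `r` bounds the Schur complements from below; the other half is the slack left for the
  -- matrix.
  have hform : ∀ n ξ, (r / 2) • (star (ξ 0) * ξ 0) ≤ toeplitzForm x (1 - r / 2) n ξ := by
    intro n ξ
    have h0 := toeplitzForm_nonneg (x := x) (e := 1 - r) (fun z => by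
      have := sub_nonneg.2 (h z)
      rw [sub_smul, one_smul]
      convert this using 1
      abel) n ξ
    rw [show 1 - r / 2 = 1 - r + r / 2 by ring, toeplitzForm_add]
    refine le_add_of_nonneg_of_le h0 (smul_le_smul_of_nonneg_left ?_ (by positivity))
    exact Finset.single_le_sum (f := fun i => star (ξ i) * ξ i)
      (fun i _ => star_mul_self_nonneg _) (Finset.mem_range.2 n.succ_pos)
  have hR := smul_one_le_riccatiSeq (half_pos hr) hform
  obtain ⟨N, hN⟩ := exists_nat_gt (4 / r)
  have hN0 : (0 : ℝ) < N := (by positivity : (0 : ℝ) < 4 / r).trans hN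
  have hNr : (N : ℝ)⁻¹ ≤ r / 4 := by
    rw [inv_le_comm₀ hN0 (by positivity), inv_div]
    exact hN.le
  have hM := smul_nonneg (inv_nonneg.2 hN0.le) (riccati_blockMatrix_nonneg (half_pos hr) hR N)
  set S := ∑ n ∈ Finset.range N, riccatiSeq x (1 - r / 2) n
  -- This correction of the upper corner brings the diagonal sum to exactly `1 - r/4`. Adding `r/4`
  -- to each corner would overshoot; `r/8` on each gives sum 1 and the final margin.
  have hp : 0 ≤ (r / 4 - (N : ℝ)⁻¹ * (1 - r / 2)) • (1 : A)
      + (N : ℝ)⁻¹ • riccatiSeq x (1 - r / 2) N := by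
    refine add_nonneg (smul_nonneg ?_ zero_le_one) (smul_nonneg (by positivity) ?_)
    · nlinarith [inv_pos.2 hN0]
    · exact (smul_nonneg (by positivity) zero_le_one).trans (hR N)
  have hD := add_nonneg hM (blockDiagonal_nonneg hp le_rfl)
  have hfin : (r / 8) • (1 : CStarMatrix (Fin 2) (Fin 2) A) ≤ CStarMatrix.ofMatrix
      !![1 - ((N : ℝ)⁻¹ • S + (r / 8) • (1 : A)), x;
        star x, (N : ℝ)⁻¹ • S + (r / 8) • (1 : A)] := by
    rw [← sub_nonneg]
    refine hD.trans_eq ?_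
    have hone : (r / 8) • (1 : CStarMatrix (Fin 2) (Fin 2) A)
        = CStarMatrix.ofMatrix !![(r / 8) • (1 : A), 0; 0, (r / 8) • (1 : A)] := by
      ext i j
      change (r / 8) • (1 : CStarMatrix (Fin 2) (Fin 2) A) i j = _
      fin_cases i <;> fin_cases j <;> simp
    rw [CStarMatrix.smul_of, CStarMatrix.of_add_of, hone, CStarMatrix.of_sub_of]
    congr 1
    ext i j
    fin_cases i <;> fin_cases j
    · change (N : ℝ)⁻¹ • ((N * (1 - r / 2)) • (1 : A) + (1 - r / 2) • (1 : A)
          - riccatiSeq x (1 - r / 2) N - S) + ((r / 4 - (N : ℝ)⁻¹ * (1 - r / 2)) • (1 : A)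
          + (N : ℝ)⁻¹ • riccatiSeq x (1 - r / 2) N)
        = 1 - ((N : ℝ)⁻¹ • S + (r / 8) • (1 : A)) - (r / 8) • (1 : A)
      match_scalars <;> field_simp <;> ring
    · simp [inv_smul_smul₀ hN0.ne']
    · simp [inv_smul_smul₀ hN0.ne']
    · simp
  have hpos := isStrictlyPositive_iff_exists_smul_one_le.2 ⟨r / 8, by positivity, hfin⟩
  -- The diagonal entries inherit strict positivity from the matrix.
  obtain ⟨ε, hε, p, q, s, t, ha, -, hb⟩ := exists_factorization_of_isStrictlyPositive hpos
  refine ⟨_, _, ?_, ?_, hpos, sub_add_cancel _ _⟩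
  · rw [ha]
    exact isStrictlyPositive_iff_exists_smul_one_le.2 ⟨ε, hε, le_add_of_nonneg_right
      (add_nonneg (star_mul_self_nonneg _) (star_mul_self_nonneg _))⟩
  · rw [hb]
    exact isStrictlyPositive_iff_exists_smul_one_le.2 ⟨ε, hε, le_add_of_nonneg_right
      (add_nonneg (star_mul_self_nonneg _) (star_mul_self_nonneg _))⟩

end Toeplitz

end

/-- Here `IsStrictlyPositive a` means that `a` is positive and invertible. The universe `v` of the
auxiliary algebras is arbitrary. -/
theorem theorem1p1 (A : Type u) [CStarAlgebra A] [PartialOrder A] [StarOrderedRing A]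
    (x : A) :
    List.TFAE [
      numericalRadius x < 1 / 2,
      ∀ (B : Type v) [CStarAlgebra B] [PartialOrder B] [StarOrderedRing B] (v : unitary B),
        numericalRadius (MinTensor.tmul x (v : B)) < 1 / 2,
      ∀ (B : Type v) [CStarAlgebra B] [PartialOrder B] [StarOrderedRing B] (v : unitary B),
        IsStrictlyPositive (MinTensor.tmul (1 : A) (1 : B) + MinTensor.tmul x (v : B)
          + MinTensor.tmul (star x) (star (v : B))),
      IsStrictlyPositive (MinTensor.tmul (1 : A) (1 : UniversalUnitaryAlgebra)
        + MinTensor.tmul x (universalUnitary : UniversalUnitaryAlgebra)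
        + MinTensor.tmul (star x) (star (universalUnitary : UniversalUnitaryAlgebra))),
      ∀ z : Circle, IsStrictlyPositive (1 + (z : ℂ) • x + star (z : ℂ) • star x),
      ∃ a b : A, IsStrictlyPositive a ∧ IsStrictlyPositive b ∧
        IsStrictlyPositive (CStarMatrix.ofMatrix !![a, x; star x, b]) ∧ a + b = 1] := by
  tfae_have 1 → 5 := isStrictlyPositive_pencil_of_numericalRadius_lt
  tfae_have 5 → 6 := fun h => by
    obtain ⟨r, hr, hle⟩ := exists_uniform_le_pencil h
    exact exists_blockMatrix_of_uniform_le_pencil hr hle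
  tfae_have 6 → 3 := fun ⟨a, b, _, _, h, hab⟩ B _ _ _ v =>
    isStrictlyPositive_tmul_of_blockMatrix hab h v
  -- Not an instance of 3: `C(𝕋)` lives in the lowest universe, whereas `B` in 3 ranges over
  -- universe `v`.
  tfae_have 6 → 4 := fun ⟨a, b, _, _, h, hab⟩ =>
    isStrictlyPositive_tmul_of_blockMatrix hab h universalUnitary
  tfae_have 3 → 2 := fun h B _ _ _ v => by
    refine numericalRadius_lt_of_isStrictlyPositive_pencil fun z => ?_
    have hz : (z : ℂ) • (v : B) ∈ unitary B := by
      have hz1 : star (z : ℂ) * z = 1 := by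
        rw [Complex.star_def, ← Circle.coe_inv_eq_conj, ← Circle.coe_mul, inv_mul_cancel,
          Circle.coe_one]
      rw [Unitary.mem_iff, star_smul, smul_mul_smul_comm, smul_mul_smul_comm, mul_comm (z : ℂ),
        hz1, one_smul, one_smul, Unitary.coe_star_mul_self, Unitary.mul_star_self_of_mem v.2]
      exact ⟨rfl, rfl⟩
    have := h B ⟨_, hz⟩
    rwa [star_smul, MinTensor.tmul_smul, MinTensor.tmul_smul, MinTensor.tmul_one_one,
      ← MinTensor.star_tmul] at this
  -- Functions on one point realise `ℂ` in universe `v`; evaluation there is a state.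
  tfae_have 2 → 1 := fun h =>
    (numericalRadius_le_numericalRadius_tmul x (evalState (PUnit.unit : PUnit.{v + 1})).2).trans_lt
      (h C(PUnit.{v + 1}, ℂ) 1)
  tfae_have 4 → 5 := isStrictlyPositive_pencil_of_tmul_universalUnitary
  tfae_finish
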